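/- Let $q$ and $a$ be complex numbers with $|q|<1$ and $a^2q^{2n}\neq 1$ for every integer $n\ge 0$. Then the series $\sum_{n\ge 0} \frac{q^n}{1-a^2q^{2n}}$ converges absolutely, and its sum is the value of a convergent infinite continued fraction: $$\sum_{n=0}^{\infty}\frac{q^n}{1-a^2q^{2n}}=\cfrac{1}{1-q+\cfrac{-a^2(1-q)^2}{1-q^3+\cfrac{-q\,a^2(1-q^2)^2}{1-q^5+\cfrac{-q^2a^2(1-q^3)^2}{1-q^7+\cdots}}}}$$ Here the first partial numerator is $1$, the $(n+2)$-nd is $-q^n a^2(1-q^{n+1})^2$ for $n\ge 0$, and the $(n+1)$-st partial denominator is $1-q^{2n+1}$ for $n\ge 0$. Convergence means that all but finitely many convergents $A_n/B_n$ have $B_n\ne 0$ and that they tend to the stated sum. -/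

import Mathlib

/-- The continued fraction `a₀/(b₀ + a₁/(b₁ + a₂/(b₂ + ⋯)))` with head term `0`, partial numerators
`num 0, num 1, …` and partial denominators `den 0, den 1, …`. -/
def infiniteContFract (num den : ℕ → ℂ) : GenContFract ℂ :=
  ⟨0, Stream'.Seq.ofStream (fun n : ℕ => (⟨num n, den n⟩ : GenContFract.Pair ℂ))⟩

/-- A continued fraction converges to the finite value `z`: its convergents `Aₙ / Bₙ` are defined
(that is, `Bₙ ≠ 0`) for all but finitely many `n`, and they tend to `z`. -/
def ContFractConvergesTo (g : GenContFract ℂ) (z : ℂ) : Prop :=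
  (∀ᶠ n in Filter.atTop, g.dens n ≠ 0) ∧ Filter.Tendsto g.convs Filter.atTop (nhds z)

/-- The partial numerators `1, -a²(1-q)², -q a²(1-q²)², -q² a²(1-q³)², …`. -/
def ramanujanNum (a q : ℂ) : ℕ → ℂ
  | 0 => 1
  | n + 1 => -(q ^ n * a ^ 2 * (1 - q ^ (n + 1)) ^ 2)

/-- The partial denominators `1 - q, 1 - q³, 1 - q⁵, …`. -/
def ramanujanDen (q : ℂ) (n : ℕ) : ℂ := 1 - q ^ (2 * n + 1)

open Filter Topology Finset

/-! Put x = a², p = q², and let A_N/B_N be the convergents. The series R_N = `heineRemainder` start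
at the required sum R_0, and their three-term recurrence (`heineRemainder_recurrence`), once R_N is
multiplied by F_N = `remainderFactor`, is that of the continued fraction. Hence R_0 B_N - A_N = F_N
R_N (`nums_eq`), that is, A_N/B_N = R_0 - F_N R_N/B_N where B_N ≠ 0. Since F_N → 0 and R_N →
(p;p)_∞/(x;p)_∞ ≠ 0, only a nonzero limit of B_N is missing. It comes from `casoratian_eq`, where
F_N is divided out so that the identity stays informative when F_N = 0 (a = 0 or q = 0): it is a
first-order recurrence for B_N whose feedback coefficient tends to 0. -/

/-- The finite `q`-Pochhammer symbol `(x; p)ₖ = ∏_{i < k} (1 - x pⁱ)`. -/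
def qPoch (x p : ℂ) (k : ℕ) : ℂ := ∏ i ∈ range k, (1 - x * p ^ i)

theorem qPoch_succ (x p : ℂ) (k : ℕ) : qPoch x p (k + 1) = qPoch x p k * (1 - x * p ^ k) :=
  prod_range_succ _ _

theorem qPoch_ne_zero {x p : ℂ} (hx : ∀ n : ℕ, x * p ^ n ≠ 1) (k : ℕ) : qPoch x p k ≠ 0 :=
  prod_ne_zero_iff.2 fun i _ => sub_ne_zero.2 (hx i).symm

theorem mul_pow_self_ne_one {p : ℂ} (hp : ‖p‖ < 1) (n : ℕ) : p * p ^ n ≠ 1 := by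
  intro h
  have h1 : ‖p ^ (n + 1)‖ < 1 := by
    rw [norm_pow]
    exact pow_lt_one₀ (norm_nonneg _) hp (Nat.succ_ne_zero n)
  rw [pow_succ', h] at h1
  simp at h1

/-- The infinite product `(x; p)_∞` converges to a nonzero value if no factor vanishes. -/
theorem exists_tendsto_qPoch {x p : ℂ} (hp : ‖p‖ < 1) (hx : ∀ n : ℕ, x * p ^ n ≠ 1) :
    ∃ L : ℂ, L ≠ 0 ∧ Tendsto (qPoch x p) atTop (𝓝 L) := by
  have hs : Summable fun i : ℕ => ‖-(x * p ^ i)‖ := by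
    simp only [norm_neg, norm_mul, norm_pow]
    exact (summable_geometric_of_lt_one (norm_nonneg _) hp).mul_left _
  refine ⟨∏' i : ℕ, (1 + -(x * p ^ i)), tprod_one_add_ne_zero_of_summable (fun i => ?_) hs, ?_⟩
  · rw [← sub_eq_add_neg]
    exact sub_ne_zero.2 (hx i).symm
  · have h := (multipliable_one_add_of_summable hs).hasProd.tendsto_prod_nat
    simp only [← sub_eq_add_neg] at h ⊢
    exact h

theorem exists_norm_le_of_tendsto {u : ℕ → ℂ} {L : ℂ} (hu : Tendsto u atTop (𝓝 L)) :
    ∃ C : ℝ, 0 ≤ C ∧ ∀ n, ‖u n‖ ≤ C := by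
  obtain ⟨C, hC⟩ := (Metric.isBounded_range_of_tendsto u hu).exists_norm_le
  exact ⟨C, (norm_nonneg _).trans (hC _ ⟨0, rfl⟩), fun n => hC _ ⟨n, rfl⟩⟩

/-- A solution of `uₙ₊₁ = αₙ + εₙ uₙ` with `εₙ → 0` has the same limit as `α`. -/
theorem tendsto_of_affine_recurrence {u α ε : ℕ → ℂ} {L : ℂ}
    (h : ∀ n, u (n + 1) = α n + ε n * u n) (hα : Tendsto α atTop (𝓝 L))
    (hε : Tendsto ε atTop (𝓝 0)) : Tendsto u atTop (𝓝 L) := by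
  obtain ⟨C, hC0, hC⟩ := exists_norm_le_of_tendsto hα
  have hhalf : ∀ᶠ n in atTop, ‖ε n‖ < 1 / 2 := by
    have := hε.norm
    rw [norm_zero] at this
    exact this.eventually_lt_const (by norm_num)
  obtain ⟨N, hN⟩ := eventually_atTop.1 hhalf
  -- With M the maximum, C ≤ M/2 and ‖ε n‖ < 1/2 make the bound M self-reproducing.
  have hM : ∀ n ≥ N, ‖u n‖ ≤ max (2 * C) ‖u N‖ := by
    intro n hn
    induction n, hn using Nat.le_induction with
    | base => exact le_max_right _ _
    | succ n hn ih =>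
      have h1 : ‖ε n * u n‖ ≤ 1 / 2 * max (2 * C) ‖u N‖ := by
        rw [norm_mul]
        exact mul_le_mul (hN n hn).le ih (norm_nonneg _) (by norm_num)
      have h2 := le_max_left (2 * C) ‖u N‖
      have h3 := norm_add_le (α n) (ε n * u n)
      rw [h n]
      linarith [hC n]
  have hbdd : IsBoundedUnder (· ≤ ·) atTop ((‖·‖) ∘ u) :=
    ⟨_, eventually_map.2 (eventually_atTop.2 ⟨N, hM⟩)⟩
  have h0 := hα.add (hε.zero_mul_isBoundedUnder_le hbdd)
  rw [add_zero] at h0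
  rw [← tendsto_add_atTop_iff_nat 1]
  exact h0.congr fun n => (h n).symm

theorem tsum_eq_zero_of_telescoping {f G : ℕ → ℂ} (hf : Summable f)
    (h : ∀ m, f m = G (m + 1) - G m) (h0 : G 0 = 0) (hG : Tendsto G atTop (𝓝 0)) :
    ∑' m, f m = 0 := by
  refine tendsto_nhds_unique hf.hasSum.tendsto_sum_nat (hG.congr fun n => ?_)
  rw [sum_congr rfl fun m _ => h m, sum_range_sub, h0, sub_zero]

/-! ### Heine-type series and their contiguous relations -/

/-- The coefficient `(p^{m+1}; p)ₙ / (x pᵐ; p)ₙ₊₁` with `p = q²`. -/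
noncomputable def heineCoeff (q x : ℂ) (n m : ℕ) : ℂ :=
  qPoch (q ^ 2) (q ^ 2) (m + n) / qPoch (q ^ 2) (q ^ 2) m *
    (qPoch x (q ^ 2) m / qPoch x (q ^ 2) (m + n + 1))

/-- The series `∑ₘ q^{em} (p^{m+1}; p)ₙ / (x pᵐ; p)ₙ₊₁` with `p = q²`. -/
noncomputable def heineSeries (q x : ℂ) (e n : ℕ) : ℂ := ∑' m : ℕ, q ^ (e * m) * heineCoeff q x n m

/-- The remainders of the continued fraction, up to an elementary factor. -/
noncomputable def heineRemainder (q x : ℂ) (N : ℕ) : ℂ :=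
  heineSeries q x (2 * ((N + 1) / 2) + 1) (N / 2)

theorem heineRemainder_even (q x : ℂ) (n : ℕ) :
    heineRemainder q x (2 * n) = heineSeries q x (2 * n + 1) n := by
  unfold heineRemainder
  congr 1 <;> omega

theorem heineRemainder_odd (q x : ℂ) (n : ℕ) :
    heineRemainder q x (2 * n + 1) = heineSeries q x (2 * n + 3) n := by
  unfold heineRemainder
  congr 1 <;> omega

section

variable {q x : ℂ}

theorem norm_sq_lt_one (hq : ‖q‖ < 1) : ‖q ^ 2‖ < 1 := by
  rw [norm_pow]
  exact pow_lt_one₀ (norm_nonneg _) hq two_ne_zero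

/-- Both Pochhammer sequences have nonzero limits, so they and their inverses are bounded.
Uniformity in `n` is what dominated convergence needs later. -/
theorem exists_norm_heineCoeff_le (hq : ‖q‖ < 1) (hx : ∀ n : ℕ, x * (q ^ 2) ^ n ≠ 1) :
    ∃ C : ℝ, 0 ≤ C ∧ ∀ n m, ‖heineCoeff q x n m‖ ≤ C := by
  have hp := norm_sq_lt_one hq
  obtain ⟨L, hL, hP⟩ := exists_tendsto_qPoch hp (mul_pow_self_ne_one hp)
  obtain ⟨K, hK, hX⟩ := exists_tendsto_qPoch hp hx
  obtain ⟨C₁, h₁, H₁⟩ := exists_norm_le_of_tendsto hP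
  obtain ⟨C₂, h₂, H₂⟩ := exists_norm_le_of_tendsto (hP.inv₀ hL)
  obtain ⟨C₃, h₃, H₃⟩ := exists_norm_le_of_tendsto hX
  obtain ⟨C₄, h₄, H₄⟩ := exists_norm_le_of_tendsto (hX.inv₀ hK)
  refine ⟨C₁ * C₂ * (C₃ * C₄), by positivity, fun n m => ?_⟩
  rw [heineCoeff, div_eq_mul_inv, div_eq_mul_inv, norm_mul, norm_mul, norm_mul]
  gcongr
  exacts [H₁ _, H₂ _, H₃ _, H₄ _]

theorem norm_pow_mul_le (hq : ‖q‖ < 1) {e : ℕ} (he : 1 ≤ e) (m : ℕ) :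
    ‖q ^ (e * m)‖ ≤ ‖q‖ ^ m := by
  rw [norm_pow]
  exact pow_le_pow_of_le_one (norm_nonneg _) hq.le (Nat.le_mul_of_pos_left m he)

theorem summable_heine (hq : ‖q‖ < 1) (hx : ∀ n : ℕ, x * (q ^ 2) ^ n ≠ 1) {e : ℕ} (he : 1 ≤ e)
    (n : ℕ) : Summable fun m : ℕ => q ^ (e * m) * heineCoeff q x n m := by
  obtain ⟨C, hC, h⟩ := exists_norm_heineCoeff_le hq hx
  refine Summable.of_norm_bounded
    ((summable_geometric_of_lt_one (norm_nonneg q) hq).mul_right C) fun m => ?_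
  rw [norm_mul]
  exact mul_le_mul (norm_pow_mul_le hq he m) (h n m) (norm_nonneg _) (by positivity)

theorem one_sub_mul_ne_zero (hx : ∀ n : ℕ, x * (q ^ 2) ^ n ≠ 1) (n : ℕ) :
    1 - x * (q ^ 2) ^ n ≠ 0 := sub_ne_zero.2 (hx n).symm

theorem heineCoeff_zero (hx : ∀ n : ℕ, x * (q ^ 2) ^ n ≠ 1) (hq : ‖q‖ < 1) (m : ℕ) :
    heineCoeff q x 0 m = (1 - x * (q ^ 2) ^ m)⁻¹ := by
  have hP := qPoch_ne_zero (mul_pow_self_ne_one (norm_sq_lt_one hq)) m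
  have hX := qPoch_ne_zero hx m
  have h := one_sub_mul_ne_zero hx m
  rw [heineCoeff, add_zero, qPoch_succ]
  field_simp

theorem heineCoeff_succ_left (n m : ℕ) :
    heineCoeff q x (n + 1) m = heineCoeff q x n m *
      ((1 - q ^ 2 * (q ^ 2) ^ (m + n)) / (1 - x * (q ^ 2) ^ (m + n + 1))) := by
  rw [heineCoeff, heineCoeff, ← add_assoc, qPoch_succ, qPoch_succ x _ (m + n + 1)]
  simp only [div_eq_mul_inv, mul_inv]
  ring

theorem heineCoeff_succ_right (hq : ‖q‖ < 1) (hx : ∀ n : ℕ, x * (q ^ 2) ^ n ≠ 1) (n m : ℕ) :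
    heineCoeff q x n (m + 1) * (1 - (q ^ 2) ^ (m + 1)) = heineCoeff q x n m *
      ((1 - q ^ 2 * (q ^ 2) ^ (m + n)) * (1 - x * (q ^ 2) ^ m) /
        (1 - x * (q ^ 2) ^ (m + n + 1))) := by
  have h1 : 1 - q ^ 2 * (q ^ 2) ^ m ≠ 0 :=
    sub_ne_zero.2 (mul_pow_self_ne_one (norm_sq_lt_one hq) m).symm
  have hP := qPoch_ne_zero (mul_pow_self_ne_one (norm_sq_lt_one hq)) m
  have hX := qPoch_ne_zero hx (m + n + 1)
  have h2 := one_sub_mul_ne_zero hx (m + n + 1)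
  rw [heineCoeff, heineCoeff, show m + 1 + n = m + n + 1 by ring, qPoch_succ, qPoch_succ _ _ m,
    qPoch_succ x _ m, qPoch_succ x _ (m + n + 1), pow_succ' (q ^ 2) m]
  field_simp

/-- The factor `1 - (q ^ 2) ^ m` removes the boundary term at `m = 0`; this lemma removes the one at
infinity. -/
theorem tendsto_telescoper (hq : ‖q‖ < 1) (hx : ∀ n : ℕ, x * (q ^ 2) ^ n ≠ 1) {e : ℕ}
    (he : 1 ≤ e) (n : ℕ) (c : ℂ) :
    Tendsto (fun m : ℕ => c * (q ^ (e * m) * (heineCoeff q x n m * (1 - (q ^ 2) ^ m))))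
      atTop (𝓝 0) := by
  have h1 := (summable_heine hq hx he n).tendsto_atTop_zero
  have h2 : Tendsto (fun m : ℕ => 1 - (q ^ 2) ^ m) atTop (𝓝 (1 - 0)) :=
    tendsto_const_nhds.sub (tendsto_pow_atTop_nhds_zero_of_norm_lt_one (norm_sq_lt_one hq))
  have h3 := (h1.mul h2).const_mul c
  simp only [zero_mul, mul_zero] at h3
  exact h3.congr fun m => by ring

/-- Three-term relation between the series, from a telescoping certificate `c`. -/
theorem heineSeries_relation (hq : ‖q‖ < 1) (hx : ∀ n : ℕ, x * (q ^ 2) ^ n ≠ 1)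
    {e₁ n₁ e₂ n₂ e₃ n₃ : ℕ} (h₁ : 1 ≤ e₁) (h₂ : 1 ≤ e₂) (h₃ : 1 ≤ e₃) (a b d c : ℂ) {e n : ℕ}
    (he : 1 ≤ e)
    (h : ∀ m, a * (q ^ (e₁ * m) * heineCoeff q x n₁ m) - b * (q ^ (e₂ * m) * heineCoeff q x n₂ m) +
        d * (q ^ (e₃ * m) * heineCoeff q x n₃ m) =
      c * (q ^ (e * (m + 1)) * (heineCoeff q x n (m + 1) * (1 - (q ^ 2) ^ (m + 1)))) -
        c * (q ^ (e * m) * (heineCoeff q x n m * (1 - (q ^ 2) ^ m)))) :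
    a * heineSeries q x e₁ n₁ = b * heineSeries q x e₂ n₂ - d * heineSeries q x e₃ n₃ := by
  have s₁ := (summable_heine hq hx h₁ n₁).mul_left a
  have s₂ := (summable_heine hq hx h₂ n₂).mul_left b
  have s₃ := (summable_heine hq hx h₃ n₃).mul_left d
  have key := tsum_eq_zero_of_telescoping ((s₁.sub s₂).add s₃) h (by simp)
    (tendsto_telescoper hq hx he n c)
  rw [(s₁.sub s₂).tsum_add s₃, s₁.tsum_sub s₂, tsum_mul_left, tsum_mul_left, tsum_mul_left] at key
  unfold heineSeries
  linear_combination key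

theorem heineRemainder_recurrence (hq : ‖q‖ < 1) (hx : ∀ n : ℕ, x * (q ^ 2) ^ n ≠ 1) (N : ℕ) :
    q ^ (N + 1) * (1 - q ^ (N + 2)) * x * heineRemainder q x (N + 2) =
      (1 - q ^ (2 * N + 3)) * heineRemainder q x (N + 1) -
        (1 - q ^ (N + 1)) * heineRemainder q x N := by
  obtain ⟨n, rfl | rfl⟩ := N.even_or_odd'
  · rw [show 2 * n + 2 = 2 * (n + 1) by ring, heineRemainder_even, heineRemainder_odd,
      heineRemainder_even, show 2 * (n + 1) + 1 = 2 * n + 3 by ring]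
    -- The certificate is a constant times the summand of R_N times 1 - p^m; the constant is -1 for
    -- N even, q^{N+1} for N odd.
    refine heineSeries_relation hq hx (by omega) (by omega) (by omega) _ _ _ (-1)
      (e := 2 * n + 1) (n := n) (by omega) fun m => ?_
    have h := one_sub_mul_ne_zero hx (m + n + 1)
    rw [heineCoeff_succ_right hq hx, heineCoeff_succ_left]
    field_simp
    ring
  · rw [show 2 * n + 1 + 2 = 2 * (n + 1) + 1 by ring, heineRemainder_odd,
      show 2 * n + 1 + 1 = 2 * (n + 1) by ring, heineRemainder_even, heineRemainder_odd,
      show 2 * (n + 1) + 1 = 2 * n + 3 by ring]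
    refine heineSeries_relation hq hx (by omega) (by omega) (by omega) _ _ _ (q ^ (2 * n + 2))
      (e := 2 * n + 3) (n := n) (by omega) fun m => ?_
    have h := one_sub_mul_ne_zero hx (m + n + 1)
    rw [heineCoeff_succ_right hq hx, heineCoeff_succ_left]
    field_simp
    ring

theorem heineRemainder_zero (hq : ‖q‖ < 1) (hx : ∀ n : ℕ, x * (q ^ 2) ^ n ≠ 1) :
    heineRemainder q x 0 = ∑' m : ℕ, q ^ m / (1 - x * q ^ (2 * m)) := by
  refine tsum_congr fun m => ?_
  change q ^ (1 * m) * heineCoeff q x 0 m = _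
  rw [heineCoeff_zero hx hq, one_mul, pow_mul, div_eq_mul_inv]

theorem heineRemainder_initial (hq : ‖q‖ < 1) (hx : ∀ n : ℕ, x * (q ^ 2) ^ n ≠ 1) :
    (1 - q) * heineRemainder q x 0 - (1 - q) * x * heineRemainder q x 1 = 1 := by
  have s₀ := summable_heine hq hx (le_refl 1) 0
  have s₁ := summable_heine hq hx (show 1 ≤ 3 by norm_num) 0
  have hsub : heineSeries q x 1 0 - x * heineSeries q x 3 0 = (1 - q)⁻¹ := by
    rw [← tsum_geometric_of_norm_lt_one hq, heineSeries, heineSeries, ← tsum_mul_left,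
      ← s₀.tsum_sub (s₁.mul_left x)]
    -- As q^{3m} = q^m p^m, the factor 1 - x p^m cancels and a geometric series remains.
    refine tsum_congr fun m => ?_
    have h := one_sub_mul_ne_zero hx m
    rw [heineCoeff_zero hx hq]
    field_simp
    ring
  have h1 : 1 - q ≠ 0 := by
    refine sub_ne_zero.2 fun h => ?_
    rw [← h] at hq
    simp at hq
  have e0 := heineRemainder_even q x 0
  have e1 := heineRemainder_odd q x 0
  norm_num at e0 e1
  rw [e0, e1, mul_assoc, ← mul_sub, hsub, mul_inv_cancel₀ h1]

theorem exists_tendsto_heineRemainder (hq : ‖q‖ < 1) (hx : ∀ n : ℕ, x * (q ^ 2) ^ n ≠ 1) :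
    ∃ τ : ℂ, τ ≠ 0 ∧ Tendsto (heineRemainder q x) atTop (𝓝 τ) := by
  have hp := norm_sq_lt_one hq
  obtain ⟨L, hL, hP⟩ := exists_tendsto_qPoch hp (mul_pow_self_ne_one hp)
  obtain ⟨K, hK, hX⟩ := exists_tendsto_qPoch hp hx
  obtain ⟨C, hC, hF⟩ := exists_norm_heineCoeff_le hq hx
  have hdiv : Tendsto (fun N : ℕ => N / 2) atTop atTop := Nat.tendsto_div_const_atTop two_ne_zero
  refine ⟨L / K, div_ne_zero hL hK, ?_⟩
  -- The growing exponent of q kills every term except m = 0.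
  have h := tendsto_tsum_of_dominated_convergence (𝓕 := atTop)
    (f := fun N m : ℕ => q ^ ((2 * ((N + 1) / 2) + 1) * m) * heineCoeff q x (N / 2) m)
    (g := fun m => if m = 0 then L / K else 0)
    ((summable_geometric_of_lt_one (norm_nonneg q) hq).mul_right C) (fun m => ?_)
    (Eventually.of_forall fun N m => ?_)
  · rw [tsum_ite_eq] at h
    exact h
  · rcases Nat.eq_zero_or_pos m with rfl | hm
    · have h1 := (hP.comp hdiv).div (hX.comp ((tendsto_add_atTop_nat 1).comp hdiv)) hK
      rw [if_pos rfl]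
      refine h1.congr fun N => ?_
      simp [heineCoeff, qPoch, div_eq_mul_inv]
    · rw [if_neg hm.ne']
      have h1 : Tendsto (fun N : ℕ => ‖q‖ ^ N * C) atTop (𝓝 0) := by
        simpa using (tendsto_pow_atTop_nhds_zero_of_lt_one (norm_nonneg q) hq).mul_const C
      refine squeeze_zero_norm (fun N => ?_) h1
      rw [norm_mul, norm_pow]
      refine mul_le_mul (pow_le_pow_of_le_one (norm_nonneg _) hq.le ?_) (hF _ _) (norm_nonneg _)
        (by positivity)
      have h2 : N ≤ 2 * ((N + 1) / 2) + 1 := by omega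
      exact h2.trans (Nat.le_mul_of_pos_right _ hm)
  · rw [norm_mul]
    exact mul_le_mul (norm_pow_mul_le hq (by omega) m) (hF _ m) (norm_nonneg _) (by positivity)

end

/-! ### Numerators and denominators of the convergents -/

section

variable (num den : ℕ → ℂ)

theorem infiniteContFract_get (n : ℕ) :
    (infiniteContFract num den).s.get? n = some ⟨num n, den n⟩ := rfl

theorem infiniteContFract_dens_one : (infiniteContFract num den).dens 1 = den 0 :=
  GenContFract.first_den_eq (infiniteContFract_get num den 0)

theorem infiniteContFract_nums_zero : (infiniteContFract num den).nums 0 = 0 := rfl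

theorem infiniteContFract_nums_one : (infiniteContFract num den).nums 1 = num 0 := by
  rw [GenContFract.first_num_eq (infiniteContFract_get num den 0)]
  simp [infiniteContFract]

theorem infiniteContFract_dens_add_two (n : ℕ) : (infiniteContFract num den).dens (n + 2) =
    den (n + 1) * (infiniteContFract num den).dens (n + 1) +
      num (n + 1) * (infiniteContFract num den).dens n :=
  GenContFract.dens_recurrence (infiniteContFract_get num den (n + 1)) rfl rfl

theorem infiniteContFract_nums_add_two (n : ℕ) : (infiniteContFract num den).nums (n + 2) =
    den (n + 1) * (infiniteContFract num den).nums (n + 1) +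
      num (n + 1) * (infiniteContFract num den).nums n :=
  GenContFract.nums_recurrence (infiniteContFract_get num den (n + 1)) rfl rfl

end

/-! ### Comparison with the remainders, and convergence -/

section

variable {q a : ℂ}

/-- The ratio `qᴺ (1 - q^{N+1}) x` of consecutive elementary factors of the remainders. -/
def remainderRatio (q x : ℂ) (N : ℕ) : ℂ := q ^ N * (1 - q ^ (N + 1)) * x

theorem tendsto_remainderRatio (hq : ‖q‖ < 1) (x : ℂ) :
    Tendsto (remainderRatio q x) atTop (𝓝 0) := by
  have h := tendsto_pow_atTop_nhds_zero_of_norm_lt_one hq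
  have h1 := (h.mul (((tendsto_add_atTop_iff_nat 1).2 h).const_sub 1)).mul_const x
  simp only [zero_mul] at h1
  exact h1

/-- The Casoratian of the denominators and the remainders is `(q; q)_N`. -/
theorem casoratian_eq (hq : ‖q‖ < 1) (hx : ∀ n : ℕ, a ^ 2 * (q ^ 2) ^ n ≠ 1) (N : ℕ) :
    heineRemainder q (a ^ 2) N *
        (infiniteContFract (ramanujanNum a q) (ramanujanDen q)).dens (N + 1) -
      remainderRatio q (a ^ 2) N * heineRemainder q (a ^ 2) (N + 1) *
        (infiniteContFract (ramanujanNum a q) (ramanujanDen q)).dens N = qPoch q q N := by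
  induction N with
  | zero =>
    have h := heineRemainder_initial hq hx
    rw [infiniteContFract_dens_one, GenContFract.zeroth_den_eq_one]
    simp only [ramanujanDen, remainderRatio, qPoch, range_zero, prod_empty]
    linear_combination h
  | succ N ih =>
    have h := heineRemainder_recurrence hq hx N
    rw [qPoch_succ, ← ih, infiniteContFract_dens_add_two]
    simp only [ramanujanDen, ramanujanNum, remainderRatio]
    linear_combination
      (-(infiniteContFract (ramanujanNum a q) (ramanujanDen q)).dens (N + 1)) * h

/-- The elementary factor `q^{N(N-1)/2} (q; q)_N xᴺ` of the remainders. -/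
def remainderFactor (q x : ℂ) (N : ℕ) : ℂ := ∏ i ∈ range N, remainderRatio q x i

theorem nums_eq (hq : ‖q‖ < 1) (hx : ∀ n : ℕ, a ^ 2 * (q ^ 2) ^ n ≠ 1) (N : ℕ) :
    (infiniteContFract (ramanujanNum a q) (ramanujanDen q)).nums N =
      heineRemainder q (a ^ 2) 0 *
        (infiniteContFract (ramanujanNum a q) (ramanujanDen q)).dens N -
      remainderFactor q (a ^ 2) N * heineRemainder q (a ^ 2) N := by
  induction N using Nat.twoStepInduction with
  | zero =>
    rw [infiniteContFract_nums_zero, GenContFract.zeroth_den_eq_one]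
    simp [remainderFactor]
  | one =>
    have h := heineRemainder_initial hq hx
    rw [infiniteContFract_nums_one, infiniteContFract_dens_one]
    simp only [ramanujanDen, ramanujanNum, remainderFactor, remainderRatio, prod_range_one]
    linear_combination -h
  | more N ih₀ ih₁ =>
    have h := heineRemainder_recurrence hq hx N
    rw [infiniteContFract_nums_add_two, infiniteContFract_dens_add_two, ih₀, ih₁]
    simp only [remainderFactor, prod_range_succ]
    simp only [ramanujanDen, ramanujanNum, remainderRatio]
    -- The multiplier of the remainder recurrence is F_{N+1}.
    linear_combination
      (∏ i ∈ range N, q ^ i * (1 - q ^ (i + 1)) * a ^ 2) * q ^ N * (1 - q ^ (N + 1)) * a ^ 2 * h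

theorem exists_tendsto_dens (hq : ‖q‖ < 1) (hx : ∀ n : ℕ, a ^ 2 * (q ^ 2) ^ n ≠ 1) :
    ∃ B : ℂ, B ≠ 0 ∧
      Tendsto (infiniteContFract (ramanujanNum a q) (ramanujanDen q)).dens atTop (𝓝 B) := by
  obtain ⟨τ, hτ, hT⟩ := exists_tendsto_heineRemainder hq hx
  obtain ⟨P, hP0, hP⟩ := exists_tendsto_qPoch hq (mul_pow_self_ne_one hq)
  obtain ⟨n₀, hn₀⟩ := eventually_atTop.1 (hT.eventually_ne hτ)
  -- Solving the Casoratian identity for B_{N+1} divides by R_N, known to be nonzero only from `n₀`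
  -- on; hence the shift.
  refine ⟨P / τ, div_ne_zero hP0 hτ, (tendsto_add_atTop_iff_nat n₀).1 ?_⟩
  have hα := hP.div hT hτ
  have hε := ((tendsto_remainderRatio hq (a ^ 2)).mul
    ((tendsto_add_atTop_iff_nat 1).2 hT)).div hT hτ
  rw [zero_mul, zero_div] at hε
  refine tendsto_of_affine_recurrence (fun n => ?_) ((tendsto_add_atTop_iff_nat n₀).2 hα)
    ((tendsto_add_atTop_iff_nat n₀).2 hε)
  have h := casoratian_eq hq hx (n + n₀)
  have h0 := hn₀ (n + n₀) (Nat.le_add_left _ _)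
  rw [show n + 1 + n₀ = n + n₀ + 1 by ring]
  simp only [Pi.div_apply]
  field_simp
  linear_combination h

theorem tendsto_remainderFactor (hq : ‖q‖ < 1) (x : ℂ) :
    Tendsto (remainderFactor q x) atTop (𝓝 0) :=
  tendsto_of_affine_recurrence (α := fun _ => 0)
    (fun n => by rw [remainderFactor, prod_range_succ, zero_add, mul_comm, remainderFactor])
    tendsto_const_nhds (tendsto_remainderRatio hq x)

end

theorem proposition4 (q a : ℂ) (hq : ‖q‖ < 1) (ha : ∀ n : ℕ, a ^ 2 * q ^ (2 * n) ≠ 1) :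
    Summable (fun n : ℕ => q ^ n / (1 - a ^ 2 * q ^ (2 * n))) ∧
      ContFractConvergesTo (infiniteContFract (ramanujanNum a q) (ramanujanDen q))
        (∑' n : ℕ, q ^ n / (1 - a ^ 2 * q ^ (2 * n))) := by
  have hx : ∀ n : ℕ, a ^ 2 * (q ^ 2) ^ n ≠ 1 := fun n => by
    rw [← pow_mul]
    exact ha n
  refine ⟨(summable_heine hq hx (le_refl 1) 0).congr fun m => ?_, ?_⟩
  · rw [heineCoeff_zero hx hq, one_mul, pow_mul, div_eq_mul_inv]
  obtain ⟨B, hB, hdens⟩ := exists_tendsto_dens hq hx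
  obtain ⟨τ, -, hT⟩ := exists_tendsto_heineRemainder hq hx
  have hne := hdens.eventually_ne hB
  refine ⟨hne, ?_⟩
  rw [← heineRemainder_zero hq hx]
  have h := (((tendsto_remainderFactor hq (a ^ 2)).mul hT).div hdens hB).const_sub
    (heineRemainder q (a ^ 2) 0)
  rw [zero_mul, zero_div, sub_zero] at h
  refine h.congr' (hne.mono fun n hn => ?_)
  rw [GenContFract.convs, nums_eq hq hx]
  rw [sub_div, mul_div_cancel_right₀ _ hn]
  rfl
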